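/- Let $n\ge 1$, let $\mathcal O$ be the local ring of germs at $0\in\mathbb C^n$ of holomorphic functions, and let $\mathfrak m$ be its maximal ideal. For $f\in\mathcal O$ put $$T_{\mathcal K}(f)=\Big\langle f,\ \mathfrak m\,\tfrac{\partial f}{\partial x_1},\dots,\mathfrak m\,\tfrac{\partial f}{\partial x_n}\Big\rangle\subseteq\mathcal O .$$ An ideal $I\subset\mathcal O$ is called a moduli ideal if $I=T_{\mathcal K}(f)$ for some $f\in\mathfrak m$, and the ideal of anti-derivatives of $I$ is $\Delta_1(I)=\{f\in\mathcal O : T_{\mathcal K}(f)\subseteq I\}$. Let $I\subsetneq\mathcal O$ be a proper ideal and let $\Delta_1(I)=\langle g_1,\dots,g_q\rangle$ with $q\ge 1$. Then $I$ is a moduli ideal if and only if there is a non-empty Zariski open subset $U\subseteq\mathbb P^{q-1}_{\mathbb C}$ such that $$I=T_{\mathcal K}\Big(\sum_{k=1}^q\lambda_k g_k\Big)\qquad\text{for all } [\lambda_1:\dots:\lambda_q]\in U .$$ Thus a general $\mathbb C$-linear combination of the generators of $\Delta_1(I)$ recovers an equation with the given moduli ideal: if $I=T_{\mathcal K}(f)$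 with $f\in\mathfrak m$, then there is a non-empty Zariski open subset $U\subseteq\mathbb P^{q-1}_{\mathbb C}$ such that for all $[\lambda_1:\dots:\lambda_q]\in U$ the germ $f_\lambda=\sum_k\lambda_k g_k$ lies in $\mathfrak m$ and satisfies $T_{\mathcal K}(f_\lambda)=T_{\mathcal K}(f)$. -/

import Mathlib

open Filter Topology
open scoped LinearAlgebra.Projectivization

noncomputable section

namespace ModuliIdeal

/-- Germs of complex-valued functions form a `ℂ`-algebra (pointwise operations). -/
instance germAlgebra {X : Type*} (l : Filter X) : Algebra ℂ (Germ l ℂ) :=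
  Algebra.ofModule
    (fun c f g => Germ.inductionOn₂ f g fun _ _ => congrArg Germ.ofFun (smul_mul_assoc c _ _))
    (fun c f g => Germ.inductionOn₂ f g fun _ _ => congrArg Germ.ofFun (mul_smul_comm c _ _))

/-- The `ℂ`-algebra of germs at `0 ∈ ℂⁿ` of holomorphic functions: those germs of functions
`ℂⁿ → ℂ` which are represented by a function analytic at `0`. -/
def holomorphicGerms (n : ℕ) : Subalgebra ℂ (Germ (𝓝 (0 : Fin n → ℂ)) ℂ) where
  carrier := {F | ∃ f : (Fin n → ℂ) → ℂ, AnalyticAt ℂ f 0 ∧ Germ.ofFun f = F}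
  mul_mem' := by
    rintro _ _ ⟨f, hf, rfl⟩ ⟨g, hg, rfl⟩
    exact ⟨f * g, hf.mul hg, rfl⟩
  add_mem' := by
    rintro _ _ ⟨f, hf, rfl⟩ ⟨g, hg, rfl⟩
    exact ⟨f + g, hf.add hg, rfl⟩
  algebraMap_mem' := by
    intro c
    refine ⟨fun _ => c, analyticAt_const, ?_⟩
    rw [Algebra.algebraMap_eq_smul_one]
    refine (Germ.coe_eq.2 (Eventually.of_forall fun x => ?_)).trans
      (Germ.coe_smul c (1 : (Fin n → ℂ) → ℂ))
    simp

/-- The ring `𝒪ₙ` of germs of holomorphic functions at `0 ∈ ℂⁿ`. -/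
abbrev HolGerm (n : ℕ) : Type := holomorphicGerms n

variable {n : ℕ}

/-- The germ at `0` of a function analytic at `0`. -/
def HolGerm.mk (f : (Fin n → ℂ) → ℂ) (hf : AnalyticAt ℂ f 0) : HolGerm n :=
  ⟨Germ.ofFun f, f, hf, rfl⟩

theorem HolGerm.ind {p : HolGerm n → Prop} (h : ∀ f hf, p (HolGerm.mk f hf)) (F : HolGerm n) :
    p F := by
  obtain ⟨_, f, hf, rfl⟩ := F
  exact h f hf

theorem HolGerm.mk_eq_mk {f g : (Fin n → ℂ) → ℂ} {hf : AnalyticAt ℂ f 0}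
    {hg : AnalyticAt ℂ g 0} : HolGerm.mk f hf = HolGerm.mk g hg ↔ f =ᶠ[𝓝 0] g :=
  Subtype.ext_iff.trans Germ.coe_eq

/-- The value at the origin of a germ. -/
def HolGerm.value (F : HolGerm n) : ℂ :=
  Germ.liftOn F.1 (fun f => f 0) fun _ _ h => h.eq_of_nhds

theorem HolGerm.isUnit_iff (F : HolGerm n) : IsUnit F ↔ F.value ≠ 0 := by
  constructor
  · rintro ⟨u, rfl⟩ h0
    have h1 : ∀ G H : HolGerm n, (G * H).value = G.value * H.value := fun G H => by
      induction G using HolGerm.ind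
      induction H using HolGerm.ind
      rfl
    have h2 := h1 u.1 u.2
    rw [u.val_inv, h0, zero_mul] at h2
    exact one_ne_zero h2
  · induction F using HolGerm.ind with
    | h f hf =>
      intro h0
      have h0' : f 0 ≠ 0 := h0
      refine IsUnit.of_mul_eq_one (HolGerm.mk f⁻¹ (hf.inv h0')) ?_
      refine Subtype.ext (Germ.coe_eq.2 ?_)
      filter_upwards [hf.continuousAt.eventually_ne h0'] with x hx
      exact mul_inv_cancel₀ hx

instance : IsLocalRing (HolGerm n) := by
  have : Nontrivial (HolGerm n) := inferInstance
  refine IsLocalRing.of_nonunits_add fun F G hF hG => ?_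
  rw [mem_nonunits_iff, HolGerm.isUnit_iff, not_not] at *
  have h1 : (F + G).value = F.value + G.value := by
    induction F using HolGerm.ind
    induction G using HolGerm.ind
    rfl
  rw [h1, hF, hG, add_zero]

/-- The underlying map of the partial derivative `∂/∂xⱼ` on germs of holomorphic functions. -/
def pderivFun (j : Fin n) (F : HolGerm n) : HolGerm n :=
  ⟨Germ.map' (fun (f : (Fin n → ℂ) → ℂ) x => fderiv ℂ f x (Pi.single j 1))
      (fun _ _ h => (EventuallyEq.fderiv (𝕜 := ℂ) h).fun_comp fun L => L (Pi.single j 1)) F.1, by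
    obtain ⟨_, f, hf, rfl⟩ := F
    exact ⟨_, (ContinuousLinearMap.apply ℂ ℂ (Pi.single j (1 : ℂ))).analyticAt _ |>.comp hf.fderiv,
      rfl⟩⟩

/-- The partial derivative `∂/∂xⱼ`, a `ℂ`-linear derivation of `𝒪ₙ`. -/
def pderiv (j : Fin n) : Derivation ℂ (HolGerm n) (HolGerm n) :=
  Derivation.mk'
    { toFun := pderivFun j
      map_add' := by
        intro F G
        induction F using HolGerm.ind with
        | h f hf =>
        induction G using HolGerm.ind with
        | h g hg =>
        refine Subtype.ext (Germ.coe_eq.2 ?_)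
        filter_upwards [hf.eventually_analyticAt, hg.eventually_analyticAt] with x hx hy
        change fderiv ℂ (f + g) x _ = _
        rw [fderiv_add hx.differentiableAt hy.differentiableAt]
        rfl
      map_smul' := by
        intro c F
        induction F using HolGerm.ind with
        | h f hf =>
        refine Subtype.ext (Germ.coe_eq.2 ?_)
        filter_upwards [hf.eventually_analyticAt] with x hx
        change fderiv ℂ (c • f) x _ = _
        rw [fderiv_const_smul hx.differentiableAt]
        rfl }
    (by
      intro F G
      induction F using HolGerm.ind with
      | h f hf =>
      induction G using HolGerm.ind with
      | h g hg =>
      refine Subtype.ext (Germ.coe_eq.2 ?_)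
      filter_upwards [hf.eventually_analyticAt, hg.eventually_analyticAt] with x hx hy
      change fderiv ℂ (f * g) x _ = _
      rw [fderiv_mul hx.differentiableAt hy.differentiableAt]
      rfl)

/-- The maximal ideal `𝔪` of `𝒪ₙ`. -/
abbrev maxIdeal (n : ℕ) : Ideal (HolGerm n) := IsLocalRing.maximalIdeal (HolGerm n)

/-- The Jacobian ideal `j(f) = ⟨∂f/∂x₁, …, ∂f/∂xₙ⟩`. -/
def jacobianIdeal (f : HolGerm n) : Ideal (HolGerm n) :=
  Ideal.span (Set.range fun j => pderiv j f)

/-- `T_𝒦(f) = ⟨f, 𝔪 j(f)⟩`. -/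
def TK (f : HolGerm n) : Ideal (HolGerm n) :=
  Ideal.span {f} ⊔ maxIdeal n * jacobianIdeal f

/-- `I` is a moduli ideal if `I = T_𝒦(f)` for some `f ∈ 𝔪`. -/
def IsModuliIdeal (I : Ideal (HolGerm n)) : Prop :=
  ∃ f ∈ maxIdeal n, I = TK f

theorem TK_le_iff {f : HolGerm n} {I : Ideal (HolGerm n)} :
    TK f ≤ I ↔ f ∈ I ∧ ∀ a ∈ maxIdeal n, ∀ j, a * pderiv j f ∈ I := by
  rw [TK, sup_le_iff, Ideal.span_singleton_le_iff_mem, Ideal.mul_le]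
  refine and_congr_right fun _ => forall₂_congr fun a _ => ?_
  constructor
  · exact fun h j => h _ (Ideal.subset_span ⟨j, rfl⟩)
  · intro h b hb
    induction hb using Submodule.span_induction with
    | mem x hx => obtain ⟨j, rfl⟩ := hx; exact h j
    | zero => simp
    | add x y _ _ hx hy => rw [mul_add]; exact I.add_mem hx hy
    | smul c x _ hx =>
      rw [smul_eq_mul, mul_left_comm]
      exact I.mul_mem_left _ hx

/-- The ideal of anti-derivatives `Δ₁(I) = {f ∈ 𝒪ₙ | T_𝒦(f) ⊆ I}`. -/
def antiderivIdeal (I : Ideal (HolGerm n)) : Ideal (HolGerm n) where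
  carrier := {f | TK f ≤ I}
  zero_mem' := by simp [TK_le_iff]
  add_mem' := by
    intro f g hf hg
    rw [Set.mem_ofPred_eq, TK_le_iff] at *
    refine ⟨I.add_mem hf.1 hg.1, fun a ha j => ?_⟩
    rw [map_add, mul_add]
    exact I.add_mem (hf.2 a ha j) (hg.2 a ha j)
  smul_mem' := by
    intro r f hf
    rw [Set.mem_ofPred_eq, TK_le_iff] at *
    refine ⟨I.mul_mem_left _ hf.1, fun a ha j => ?_⟩
    rw [smul_eq_mul, Derivation.leibniz, smul_eq_mul, smul_eq_mul, mul_add]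
    refine I.add_mem ?_ ?_
    · rw [mul_left_comm]
      exact I.mul_mem_left _ (hf.2 a ha j)
    · rw [mul_left_comm]
      exact I.mul_mem_right _ hf.1

/-- A set of points of `ℙ^{q-1}(ℂ)` is Zariski open if its complement is the common zero set of
some set of homogeneous polynomials in the homogeneous coordinates. -/
def IsZariskiOpen {q : ℕ} (U : Set (ℙ ℂ (Fin q → ℂ))) : Prop :=
  ∃ S : Set (MvPolynomial (Fin q) ℂ), (∀ p ∈ S, ∃ d : ℕ, p.IsHomogeneous d) ∧
    ∀ (v : Fin q → ℂ) (hv : v ≠ 0),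
      Projectivization.mk ℂ v hv ∉ U ↔ ∀ p ∈ S, MvPolynomial.eval v p = 0

end ModuliIdeal

end

noncomputable section

namespace ModuliIdeal

variable {n : ℕ}

/-! ### Hadamard's lemma and generators of the maximal ideal -/

/-! Let `I = TK f`. Since `f` lies in its own ideal of anti-derivatives, `f = ∑ aₖ gₖ`. Replacing
each `aₖ` by its value `αₖ` at the origin changes `f` by an element of `𝔪 Δ₁(I)`. By Leibniz, the
operators `f ↦ f` and `f ↦ xᵢ ∂f/∂xⱼ` send such an element into `𝔪 I`, so Nakayama gives `TK (∑ αₖ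
gₖ) = I` (`TK_sum_valueHom_smul`). Hence some constant combination works.

For openness, let `x` be the vector of these operators at `∑ αₖ gₖ`. The vector at `gₖ` is `Cₖ x`
for a square matrix `Cₖ`, and one can arrange `∑ αₖ Cₖ = 1` (`exists_matrices_tangentOp`). By
linearity the vector at `∑ vₖ gₖ` is `(∑ vₖ Cₖ) x`, which still generates `I` when the determinant
is a unit. The value of that determinant at the origin is a homogeneous polynomial in `v` equal to
`1` at `α`, so its non-vanishing locus is the required open set. -/

theorem _root_.FormalMultilinearSeries.shift_apply_diag {E F : Type*} [NormedAddCommGroup E]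
    [NormedSpace ℂ E] [NormedAddCommGroup F] [NormedSpace ℂ F]
    (p : FormalMultilinearSeries ℂ E F) (k : ℕ) (x : E) :
    p.shift k (fun _ => x) x = p (k + 1) fun _ => x := by
  rw [FormalMultilinearSeries.shift, ContinuousMultilinearMap.curryRight_apply]
  congr 1
  funext i
  refine Fin.lastCases ?_ (fun j => ?_) i <;> simp

/-- Applying the shifted series at `x` to `x` once more gives back the original series without its
constant term. -/
theorem _root_.HasFPowerSeriesOnBall.eq_add_shift_sum {E F : Type*} [NormedAddCommGroup E]
    [NormedSpace ℂ E] [NormedAddCommGroup F] [NormedSpace ℂ F] {f : E → F}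
    {p : FormalMultilinearSeries ℂ E F} {r : ENNReal} (hp : HasFPowerSeriesOnBall f p 0 r)
    {x : E} {v : E →L[ℂ] F} (hx : x ∈ Metric.eball 0 r)
    (hv : HasSum (fun k => p.shift k fun _ => x) v) : f x = f 0 + v x := by
  have h1 := hp.hasSum hx
  rw [zero_add] at h1
  have h2 : HasSum (fun k => p (k + 1) fun _ => x) (v x) := by
    rw [← funext fun k => p.shift_apply_diag k x]
    exact hv.mapL (ContinuousLinearMap.apply ℂ F x)
  have h3 := (hasSum_nat_add_iff (f := fun k => p k fun _ => x) 1).1 h2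
  rw [Finset.sum_range_one, hp.coeff_zero, add_comm] at h3
  exact h1.unique h3

/-- Hadamard's lemma: an analytic function is its value at the origin plus the evaluation of an
analytic family of linear forms. -/
theorem _root_.AnalyticAt.exists_eventuallyEq_add_apply {E F : Type*} [NormedAddCommGroup E]
    [NormedSpace ℂ E] [NormedAddCommGroup F] [NormedSpace ℂ F] [CompleteSpace F] {f : E → F}
    (hf : AnalyticAt ℂ f 0) :
    ∃ φ : E → E →L[ℂ] F, AnalyticAt ℂ φ 0 ∧ ∀ᶠ x in 𝓝 0, f x = f 0 + φ x x := by
  obtain ⟨p, r, hp⟩ := hf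
  have hr : 0 < p.shift.radius := by
    rw [p.radius_shift]
    exact hp.r_pos.trans_le hp.r_le
  have hφ := p.shift.hasFPowerSeriesOnBall hr
  refine ⟨p.shift.sum, hφ.analyticAt, ?_⟩
  filter_upwards [Metric.eball_mem_nhds (0 : E) hp.r_pos,
    Metric.eball_mem_nhds (0 : E) hr] with x hx hx'
  have h := hφ.hasSum hx'
  rw [zero_add] at h
  exact hp.eq_add_shift_sum hx h

/-- The value at the origin, as a homomorphism of algebras. -/
def valueHom (n : ℕ) : HolGerm n →ₐ[ℂ] ℂ where
  toFun := HolGerm.value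
  map_one' := rfl
  map_zero' := rfl
  map_mul' F G := by
    induction F using HolGerm.ind
    induction G using HolGerm.ind
    rfl
  map_add' F G := by
    induction F using HolGerm.ind
    induction G using HolGerm.ind
    rfl
  commutes' c := by
    rw [Algebra.algebraMap_eq_smul_one]
    change c * 1 = c
    exact mul_one c

theorem mem_maxIdeal_iff {F : HolGerm n} : F ∈ maxIdeal n ↔ valueHom n F = 0 := by
  rw [IsLocalRing.mem_maximalIdeal, mem_nonunits_iff, HolGerm.isUnit_iff, not_not]
  rfl

theorem isUnit_iff_valueHom_ne_zero {F : HolGerm n} : IsUnit F ↔ valueHom n F ≠ 0 :=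
  HolGerm.isUnit_iff F

theorem sub_algebraMap_valueHom_mem (F : HolGerm n) :
    F - algebraMap ℂ _ (valueHom n F) ∈ maxIdeal n := by
  rw [mem_maxIdeal_iff, map_sub, AlgHom.commutes]
  exact sub_self _

/-- The germ of the coordinate function `xᵢ`. -/
def coord (i : Fin n) : HolGerm n :=
  HolGerm.mk (fun x => x i)
    ((ContinuousLinearMap.proj (R := ℂ) (φ := fun _ : Fin n => ℂ) i).analyticAt 0)

theorem coord_mem_maxIdeal (i : Fin n) : coord i ∈ maxIdeal n :=
  mem_maxIdeal_iff.2 rfl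

theorem HolGerm.sum_mul_mk {ι : Type*} (s : Finset ι) (f g : ι → (Fin n → ℂ) → ℂ)
    (hf : ∀ i, AnalyticAt ℂ (f i) 0) (hg : ∀ i, AnalyticAt ℂ (g i) 0) :
    ∑ i ∈ s, HolGerm.mk (f i) (hf i) * HolGerm.mk (g i) (hg i) =
      HolGerm.mk (fun x => ∑ i ∈ s, f i x * g i x)
        (s.analyticAt_fun_sum fun i _ => (hf i).mul (hg i)) := by
  classical
  induction s using Finset.induction_on with
  | empty => rfl
  | insert i s hi ih =>
    rw [Finset.sum_insert hi, ih]
    refine Subtype.ext (Germ.coe_eq.2 (Eventually.of_forall fun x => ?_))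
    simp [Finset.sum_insert hi]

/-- The maximal ideal is generated by the coordinate functions. -/
theorem maxIdeal_eq_span_coord : maxIdeal n = Ideal.span (Set.range coord) := by
  refine le_antisymm (fun F hF => ?_) (Ideal.span_le.2 ?_)
  · rw [mem_maxIdeal_iff] at hF
    induction F using HolGerm.ind with
    | h f hf =>
    have hf0 : f 0 = 0 := hF
    obtain ⟨φ, hφ, h⟩ := hf.exists_eventuallyEq_add_apply
    have hc : ∀ i : Fin n, AnalyticAt ℂ (fun x => φ x (Pi.single i 1)) 0 := fun i =>
      ((ContinuousLinearMap.apply ℂ ℂ (Pi.single i 1 : Fin n → ℂ)).analyticAt (φ 0)).comp hφ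
    -- Expand `x` in the standard basis inside `φ x x`: the coefficient of `xᵢ` is `φ x eᵢ`.
    have key : HolGerm.mk f hf = ∑ i, HolGerm.mk _ (hc i) * coord i := by
      refine Eq.trans ?_ (HolGerm.sum_mul_mk _ _ _ _ _).symm
      refine HolGerm.mk_eq_mk.2 ?_
      filter_upwards [h] with x hx
      rw [hx, hf0, zero_add]
      refine (congrArg (φ x) (pi_eq_sum_univ' x)).trans ?_
      rw [map_sum]
      exact Finset.sum_congr rfl fun i _ => by rw [map_smul, smul_eq_mul, mul_comm]
    rw [key]
    exact Ideal.sum_mem _ fun i _ => Ideal.mul_mem_left _ _ (Ideal.subset_span ⟨i, rfl⟩)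
  · rintro _ ⟨i, rfl⟩
    exact coord_mem_maxIdeal i

/-! ### Generators of `T_𝒦(f)` -/

/-- The linear operators `f ↦ f` and `f ↦ xᵢ ∂f/∂xⱼ`, whose values at `f` generate `T_𝒦(f)`. -/
def tangentOp : Option (Fin n × Fin n) → HolGerm n →ₗ[ℂ] HolGerm n
  | none => LinearMap.id
  | some (i, j) => LinearMap.mulLeft ℂ (coord i) ∘ₗ (pderiv j).toLinearMap

theorem TK_eq_span_tangentOp (f : HolGerm n) :
    TK f = Ideal.span (Set.range fun s => tangentOp s f) := by
  apply le_antisymm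
  · rw [TK, jacobianIdeal, maxIdeal_eq_span_coord, Ideal.span_mul_span, ← Ideal.span_union]
    refine Ideal.span_mono ?_
    rintro _ (rfl | ⟨_, ⟨i, rfl⟩, _, ⟨j, rfl⟩, rfl⟩)
    · exact ⟨none, rfl⟩
    · exact ⟨some (i, j), rfl⟩
  · rw [Ideal.span_le]
    have h := TK_le_iff.1 (le_refl (TK f))
    rintro _ ⟨_ | ⟨i, j⟩, rfl⟩
    · exact h.1
    · exact h.2 _ (coord_mem_maxIdeal i) j

/-- The finiteness needed for Nakayama; it rests on `𝔪` being generated by the finitely many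
coordinates. -/
theorem TK_fg (f : HolGerm n) : (TK f).FG := by
  rw [TK_eq_span_tangentOp]
  exact Submodule.fg_span (Set.finite_range _)

theorem TK_le_iff_tangentOp {f : HolGerm n} {I : Ideal (HolGerm n)} :
    TK f ≤ I ↔ ∀ s, tangentOp s f ∈ I := by
  rw [TK_eq_span_tangentOp, Ideal.span_le, Set.range_subset_iff]
  rfl

theorem mem_antiderivIdeal {f : HolGerm n} {I : Ideal (HolGerm n)} :
    f ∈ antiderivIdeal I ↔ TK f ≤ I := Iff.rfl

/-- Multiplying an anti-derivative by an element of `𝔪` sends all its tangent operators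
into `𝔪 I`. -/
theorem tangentOp_mul_mem {I : Ideal (HolGerm n)} {a f : HolGerm n} (ha : a ∈ maxIdeal n)
    (hf : f ∈ antiderivIdeal I) (s : Option (Fin n × Fin n)) :
    tangentOp s (a * f) ∈ maxIdeal n * I := by
  have h := TK_le_iff.1 (mem_antiderivIdeal.1 hf)
  rcases s with _ | ⟨i, j⟩
  · exact Ideal.mul_mem_mul ha h.1
  · change coord i * pderiv j (a * f) ∈ _
    -- In `a (xᵢ ∂ⱼf) + xᵢ f ∂ⱼa` the factor from `𝔪` is `a` in the first term and `xᵢ` in the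
    -- second, as `∂ⱼa` may be a unit.
    rw [Derivation.leibniz, smul_eq_mul, smul_eq_mul, mul_add, mul_left_comm]
    refine Ideal.add_mem _ (Ideal.mul_mem_mul ha (h.2 _ (coord_mem_maxIdeal i) j)) ?_
    rw [mul_comm f, ← mul_assoc, mul_comm (coord i), mul_assoc]
    exact Ideal.mul_mem_left _ _ (Ideal.mul_mem_mul (coord_mem_maxIdeal i) h.1)

/-- Replacing the coefficients of `f` with respect to generators of the ideal of anti-derivatives
by their values at the origin does not change `T_𝒦(f)`. -/
theorem TK_sum_valueHom_smul {q : ℕ} {f : HolGerm n} {g a : Fin q → HolGerm n}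
    (hg : ∀ k, g k ∈ antiderivIdeal (TK f)) (hf : f = ∑ k, a k * g k) :
    TK (∑ k, valueHom n (a k) • g k) = TK f := by
  have hle : TK (∑ k, valueHom n (a k) • g k) ≤ TK f :=
    mem_antiderivIdeal.1 (Submodule.sum_mem _ fun k _ => Submodule.smul_of_tower_mem _ _ (hg k))
  refine le_antisymm hle ?_
  -- Nakayama: it suffices that `TK f` lies in the smaller ideal plus `𝔪 * TK f`.
  refine Submodule.le_of_le_smul_of_le_jacobson_bot (I := maxIdeal n) (TK_fg f)
    (IsLocalRing.maximalIdeal_le_jacobson _) (TK_le_iff_tangentOp.2 fun s => ?_)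
  have hsplit : f = (∑ k, valueHom n (a k) • g k) +
      ∑ k, (a k - algebraMap ℂ _ (valueHom n (a k))) * g k := by
    rw [← Finset.sum_add_distrib]
    refine hf.trans (Finset.sum_congr rfl fun k _ => ?_)
    rw [sub_mul, ← Algebra.smul_def]
    abel
  have hval : tangentOp s f = tangentOp s (∑ k, valueHom n (a k) • g k) +
      ∑ k, tangentOp s ((a k - algebraMap ℂ _ (valueHom n (a k))) * g k) := by
    rw [← map_sum, ← map_add, ← hsplit]
  rw [hval]
  exact Submodule.add_mem_sup (TK_le_iff_tangentOp.1 le_rfl s)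
    (Submodule.sum_mem _ fun k _ => tangentOp_mul_mem (sub_algebraMap_valueHom_mem _) (hg k) s)

/-! ### The open set of good coefficients -/

/-- The determinant of a square matrix of homogeneous polynomials of the same degree is
homogeneous. -/
theorem isHomogeneous_det {σ ι R : Type*} [CommRing R] [Fintype ι] [DecidableEq ι] {d : ℕ}
    (M : Matrix ι ι (MvPolynomial σ R)) (hM : ∀ s t, (M s t).IsHomogeneous d) :
    M.det.IsHomogeneous (Fintype.card ι * d) := by
  rw [Matrix.det_apply]
  refine MvPolynomial.IsHomogeneous.sum _ _ _ fun τ _ => ?_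
  have h := MvPolynomial.IsHomogeneous.prod Finset.univ (fun i => M (τ i) i) (fun _ => d)
    fun i _ => hM _ _
  rw [Finset.sum_const, smul_eq_mul, Finset.card_univ] at h
  rcases Int.units_eq_one_or (Equiv.Perm.sign τ) with hτ | hτ <;> rw [hτ]
  · simpa using h
  · simpa using h.neg

theorem _root_.MvPolynomial.IsHomogeneous.eval_smul {σ R : Type*} [CommSemiring R] {d : ℕ}
    {p : MvPolynomial σ R} (hp : p.IsHomogeneous d) (c : R) (v : σ → R) :
    MvPolynomial.eval (c • v) p = c ^ d * MvPolynomial.eval v p := by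
  rw [MvPolynomial.eval_eq, MvPolynomial.eval_eq, Finset.mul_sum]
  refine Finset.sum_congr rfl fun m hm => ?_
  simp only [Pi.smul_apply, smul_eq_mul, mul_pow, Finset.prod_mul_distrib,
    Finset.prod_pow_eq_pow_sum]
  rw [hp.degree_eq_sum_deg_support hm]
  exact mul_left_comm _ _ _

/-- The non-vanishing locus in projective space of a polynomial. -/
def nonvanishingLocus {q : ℕ} (p : MvPolynomial (Fin q) ℂ) : Set (ℙ ℂ (Fin q → ℂ)) :=
  {x | MvPolynomial.eval x.rep p ≠ 0}

theorem mk_mem_nonvanishingLocus {q d : ℕ} {p : MvPolynomial (Fin q) ℂ} (hp : p.IsHomogeneous d)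
    {v : Fin q → ℂ} (hv : v ≠ 0) :
    Projectivization.mk ℂ v hv ∈ nonvanishingLocus p ↔ MvPolynomial.eval v p ≠ 0 := by
  -- The chosen representative differs from `v` by a unit `c`, which only multiplies the value by `c
  -- ^ d`.
  obtain ⟨c, hc⟩ := Projectivization.exists_smul_eq_mk_rep ℂ v hv
  change MvPolynomial.eval (Projectivization.mk ℂ v hv).rep p ≠ 0 ↔ _
  rw [← hc, Units.smul_def, hp.eval_smul]
  simp

theorem isZariskiOpen_nonvanishingLocus {q d : ℕ} {p : MvPolynomial (Fin q) ℂ}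
    (hp : p.IsHomogeneous d) : IsZariskiOpen (nonvanishingLocus p) := by
  refine ⟨{p}, by rintro _ rfl; exact ⟨d, hp⟩, fun v hv => ?_⟩
  rw [mk_mem_nonvanishingLocus hp hv, not_not]
  simp

theorem exists_matrix_of_mem_span {R ι κ : Type*} [CommRing R] [Fintype ι] {x : ι → R}
    {y : κ → R} (h : ∀ s, y s ∈ Ideal.span (Set.range x)) :
    ∃ C : Matrix κ ι R, y = C.mulVec x := by
  choose c hc using fun s => Ideal.mem_span_range_iff_exists_fun.1 (h s)
  exact ⟨c, funext fun s => (hc s).symm⟩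

/-- If the determinant of `A` is invertible then the ideal generated by the entries of `x` is
contained in the one generated by the entries of `A x`. -/
theorem span_range_le_span_range_mulVec {R ι : Type*} [CommRing R] [Fintype ι] [DecidableEq ι]
    {A : Matrix ι ι R} (hA : IsUnit A.det) (x : ι → R) :
    Ideal.span (Set.range x) ≤ Ideal.span (Set.range (A.mulVec x)) := by
  rw [Ideal.span_le]
  rintro _ ⟨s, rfl⟩
  have hx : x = A⁻¹.mulVec (A.mulVec x) := by
    rw [Matrix.mulVec_mulVec, Matrix.nonsing_inv_mul _ hA, Matrix.one_mulVec]
  have hs : x s = ∑ t, A⁻¹ s t * A.mulVec x t := congrFun hx s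
  rw [SetLike.mem_coe, hs]
  exact Ideal.sum_mem _ fun t _ => Ideal.mul_mem_left _ _ (Ideal.subset_span ⟨t, rfl⟩)

/-- Matrices expressing the tangent operators of the `gₖ` through those of `∑ αₖ gₖ` may be
chosen such that their combination with coefficients `α` is the identity. -/
theorem exists_matrices_tangentOp {q : ℕ} {g : Fin q → HolGerm n} {α : Fin q → ℂ} (hα : α ≠ 0)
    (hg : ∀ k, TK (g k) ≤ TK (∑ k, α k • g k)) :
    ∃ C : Fin q → Matrix (Option (Fin n × Fin n)) (Option (Fin n × Fin n)) (HolGerm n),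
      (∀ k, (fun s => tangentOp s (g k)) =
        (C k).mulVec fun s => tangentOp s (∑ k, α k • g k)) ∧
      ∑ k, α k • C k = 1 := by
  classical
  set x : Option (Fin n × Fin n) → HolGerm n := fun s => tangentOp s (∑ k, α k • g k) with hx
  obtain ⟨j, hj⟩ := Function.ne_iff.1 hα
  have hj : α j ≠ 0 := hj
  choose B hB using fun k => exists_matrix_of_mem_span (x := x)
    (y := fun s => tangentOp s (g k)) fun s => by
      rw [← TK_eq_span_tangentOp]
      exact TK_le_iff_tangentOp.1 (hg k) s
  have hxsum : x = ∑ k, α k • (B k).mulVec x := by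
    simp only [← hB]
    funext s
    simp only [hx, map_sum, map_smul, Finset.sum_apply, Pi.smul_apply]
  -- The defect `1 - ∑ αₖ Bₖ` kills `x`, so adding it, divided by `αⱼ`, to the single matrix `Bⱼ`
  -- preserves the relations and normalizes the sum.
  refine ⟨fun k => B k + if k = j then (α j)⁻¹ • (1 - ∑ k, α k • B k) else 0, fun k => ?_, ?_⟩
  · dsimp only
    split_ifs
    · have h0 : (1 - ∑ k, α k • B k).mulVec x = 0 := by
        rw [Matrix.sub_mulVec, Matrix.one_mulVec, Matrix.sum_mulVec]
        simp only [Matrix.smul_mulVec]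
        rw [← hxsum, sub_self]
      rw [Matrix.add_mulVec, Matrix.smul_mulVec, h0, smul_zero, add_zero]
      exact hB k
    · rw [add_zero]
      exact hB k
  · simp only [smul_add, smul_ite, smul_zero, Finset.sum_add_distrib, Finset.sum_ite_eq',
      Finset.mem_univ, if_true, smul_smul, mul_inv_cancel₀ hj, one_smul]
    abel

/-- If all `T_𝒦(gₖ)` are contained in `T_𝒦(∑ αₖ gₖ)`, then a general linear combination of
the `gₖ` has the same `T_𝒦` as `∑ αₖ gₖ`. -/
theorem exists_isHomogeneous_TK_eq {q : ℕ} {g : Fin q → HolGerm n} {α : Fin q → ℂ} (hα : α ≠ 0)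
    (hg : ∀ k, TK (g k) ≤ TK (∑ k, α k • g k)) :
    ∃ (p : MvPolynomial (Fin q) ℂ) (d : ℕ), p.IsHomogeneous d ∧ MvPolynomial.eval α p ≠ 0 ∧
      ∀ v : Fin q → ℂ, MvPolynomial.eval v p ≠ 0 →
        TK (∑ k, v k • g k) = TK (∑ k, α k • g k) := by
  classical
  obtain ⟨C, hC, hC1⟩ := exists_matrices_tangentOp hα hg
  -- Entries are linear forms in `v`: evaluating `M` at `v` gives `∑ vₖ Cₖ` reduced modulo `𝔪`.
  let M : Matrix (Option (Fin n × Fin n)) (Option (Fin n × Fin n)) (MvPolynomial (Fin q) ℂ) :=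
    Matrix.of fun s t => ∑ k, MvPolynomial.C (valueHom n (C k s t)) * MvPolynomial.X k
  have hM : ∀ s t, (M s t).IsHomogeneous 1 := fun s t =>
    MvPolynomial.IsHomogeneous.sum Finset.univ
      (fun k => MvPolynomial.C (valueHom n (C k s t)) * MvPolynomial.X k) 1
      fun k _ => MvPolynomial.isHomogeneous_C_mul_X _ _
  have heval : ∀ v : Fin q → ℂ,
      MvPolynomial.eval v M.det = valueHom n (∑ k, v k • C k).det := fun v => by
    rw [RingHom.map_det, AlgHom.map_det]
    congr 1
    ext s t
    simp [M, Matrix.sum_apply, mul_comm]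
  refine ⟨M.det, _, isHomogeneous_det M hM, ?_, fun v hv => ?_⟩
  · rw [heval, hC1, Matrix.det_one, map_one]
    exact one_ne_zero
  · refine le_antisymm (mem_antiderivIdeal.1 (Submodule.sum_mem _ fun k _ =>
      Submodule.smul_of_tower_mem _ _ (mem_antiderivIdeal.2 (hg k)))) ?_
    rw [heval, ← isUnit_iff_valueHom_ne_zero] at hv
    rw [TK_eq_span_tangentOp, TK_eq_span_tangentOp (∑ k, v k • g k)]
    refine (span_range_le_span_range_mulVec hv _).trans_eq ?_
    congr 2
    rw [Matrix.sum_mulVec]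
    simp only [Matrix.smul_mulVec, ← hC]
    funext s
    simp only [map_sum, map_smul, Finset.sum_apply, Pi.smul_apply]

theorem TK_zero : TK (0 : HolGerm n) = ⊥ := by
  rw [eq_bot_iff, TK_le_iff]
  simp

/-- A general linear combination of generators of the ideal of anti-derivatives of `T_𝒦(f)`
has the same `T_𝒦` as `f`. -/
theorem exists_isZariskiOpen_TK_eq {q : ℕ} (hq : 1 ≤ q) {f : HolGerm n} {g : Fin q → HolGerm n}
    (hg : antiderivIdeal (TK f) = Ideal.span (Set.range g)) :
    ∃ U : Set (ℙ ℂ (Fin q → ℂ)), IsZariskiOpen U ∧ U.Nonempty ∧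
      ∀ (v : Fin q → ℂ) (hv : v ≠ 0), Projectivization.mk ℂ v hv ∈ U →
        TK (∑ k, v k • g k) = TK f := by
  have hgmem : ∀ k, g k ∈ antiderivIdeal (TK f) := fun k => by
    rw [hg]
    exact Ideal.subset_span ⟨k, rfl⟩
  have hf : f ∈ Ideal.span (Set.range g) := by
    rw [← hg]
    exact mem_antiderivIdeal.2 le_rfl
  obtain ⟨a, ha⟩ := Ideal.mem_span_range_iff_exists_fun.1 hf
  have hTK := TK_sum_valueHom_smul hgmem ha.symm
  -- If `α = 0` it defines no projective point, but then `TK f = ⊥` and every combination works; `U`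
  -- is the whole space, nonempty because `1 ≤ q`.
  by_cases hα : (fun k => valueHom n (a k)) = 0
  · have h0 : TK f = ⊥ := by
      rw [← hTK, ← TK_zero]
      congr 1
      exact Finset.sum_eq_zero fun k _ => by rw [congrFun hα k, Pi.zero_apply, zero_smul]
    have hp := MvPolynomial.isHomogeneous_one (Fin q) ℂ
    have hv : (fun _ : Fin q => (1 : ℂ)) ≠ 0 := fun h => one_ne_zero (congrFun h ⟨0, hq⟩)
    refine ⟨nonvanishingLocus 1, isZariskiOpen_nonvanishingLocus hp,
      ⟨_, (mk_mem_nonvanishingLocus hp hv).2 (by simp)⟩, fun v _ _ => ?_⟩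
    rw [h0, eq_bot_iff, ← h0]
    exact mem_antiderivIdeal.1
      (Submodule.sum_mem _ fun k _ => Submodule.smul_of_tower_mem _ _ (hgmem k))
  · obtain ⟨p, d, hp, hpα, h⟩ := exists_isHomogeneous_TK_eq (g := g) hα fun k => by
      rw [hTK]
      exact mem_antiderivIdeal.1 (hgmem k)
    exact ⟨nonvanishingLocus p, isZariskiOpen_nonvanishingLocus hp,
      ⟨_, (mk_mem_nonvanishingLocus hp hα).2 hpα⟩, fun v hv hmem =>
      (h v ((mk_mem_nonvanishingLocus hp hv).1 hmem)).trans hTK⟩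

theorem mem_maxIdeal_of_TK_ne_top {f : HolGerm n} (h : TK f ≠ ⊤) : f ∈ maxIdeal n :=
  IsLocalRing.le_maximalIdeal h (TK_le_iff.1 le_rfl).1

end ModuliIdeal

end

theorem mainTheorem2 (n q : ℕ) (hq : 1 ≤ q)
    (I : Ideal (ModuliIdeal.HolGerm n)) (hI : I ≠ ⊤)
    (g : Fin q → ModuliIdeal.HolGerm n)
    (hg : ModuliIdeal.antiderivIdeal I = Ideal.span (Set.range g)) :
    (ModuliIdeal.IsModuliIdeal I ↔
      ∃ U : Set (ℙ ℂ (Fin q → ℂ)), ModuliIdeal.IsZariskiOpen U ∧ U.Nonempty ∧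
        ∀ (v : Fin q → ℂ) (hv : v ≠ 0), Projectivization.mk ℂ v hv ∈ U →
          I = ModuliIdeal.TK (∑ k, v k • g k)) ∧
    (∀ f ∈ ModuliIdeal.maxIdeal n, I = ModuliIdeal.TK f →
      ∃ U : Set (ℙ ℂ (Fin q → ℂ)), ModuliIdeal.IsZariskiOpen U ∧ U.Nonempty ∧
        ∀ (v : Fin q → ℂ) (hv : v ≠ 0), Projectivization.mk ℂ v hv ∈ U →
          (∑ k, v k • g k) ∈ ModuliIdeal.maxIdeal n ∧
          ModuliIdeal.TK (∑ k, v k • g k) = ModuliIdeal.TK f) := by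
  have key : ∀ f, I = ModuliIdeal.TK f →
      ∃ U : Set (ℙ ℂ (Fin q → ℂ)), ModuliIdeal.IsZariskiOpen U ∧ U.Nonempty ∧
        ∀ (v : Fin q → ℂ) (hv : v ≠ 0), Projectivization.mk ℂ v hv ∈ U →
          ModuliIdeal.TK (∑ k, v k • g k) = I := by
    rintro f rfl
    exact ModuliIdeal.exists_isZariskiOpen_TK_eq hq hg
  refine ⟨⟨?_, ?_⟩, fun f _ hf => ?_⟩
  · rintro ⟨f, -, hf⟩
    obtain ⟨U, hU, hne, h⟩ := key f hf
    exact ⟨U, hU, hne, fun v hv hmem => (h v hv hmem).symm⟩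
  · rintro ⟨U, -, ⟨x, hx⟩, h⟩
    -- Any one point of `U` provides the equation; it lies in `𝔪` because it belongs to the proper
    -- ideal `I`.
    have hTK := h x.rep x.rep_nonzero (by rwa [Projectivization.mk_rep])
    exact ⟨_, ModuliIdeal.mem_maxIdeal_of_TK_ne_top (hTK ▸ hI), hTK⟩
  · obtain ⟨U, hU, hne, h⟩ := key f hf
    refine ⟨U, hU, hne, fun v hv hmem => ?_⟩
    have hTK := h v hv hmem
    exact ⟨ModuliIdeal.mem_maxIdeal_of_TK_ne_top (hTK.symm ▸ hI), hTK.trans hf⟩
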